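/- Let $X,Y$ be real Banach spaces with $X$ reflexive, $\Omega\subseteq X$ open, $F:\Omega\to Y$ continuously Fréchet differentiable, $C\subseteq Y$ a nonempty closed convex cone, $x_0\in\Omega$, $L>0$, $b>0$. For $z\in\Omega$ put $T_z d:=F'(z)d-C$ and $T_z^{-1}y:=\{d\in X: F'(z)d-y\in C\}$. For a set $S$ write $\|S\|:=\inf_{v\in S}\|v\|$ ($+\infty$ if $S=\varnothing$), and for a linear map $A:X\to Y$ write $\|T_{z}^{-1}A\|:=\sup\{\|T_z^{-1}(Ad)\| : \|d\|\le 1,\ T_z^{-1}(Ad)\neq\varnothing\}$. Assume Robinson's condition $\bigcup_{d}T_{x_0}d=Y$ and the affine invariant Lipschitz condition: $B(x_0,1/L)\subseteq\Omega$ and $\|T_{x_0}^{-1}[F'(y)-F'(x)]\|\le L\|x-y\|$ for all $x,y\in B(x_0,1/L)$. Put $s:=\sqrt{2bL}$, $\lambda:=s/L$ and suppose $$\|T_{x_0}^{-1}[-F(x_0)]\|\le b,\qquad 0\le\theta\le\frac{1-s}{1+s}$$ (so $s\le 1$). Consider the inexact Newton method started at $x_0$: $x_{k+1}=x_k+d_k$,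 where for some $r_k\in Y$ $$d_k\in\operatorname*{argmin}_{d\in X}\{\|d\| : F(x_k)+F'(x_k)d+r_k\in C\},\qquad \max_{w\in\{-r_k,r_k\}}\|T_{x_0}^{-1}w\|\le\theta\,\|T_{x_0}^{-1}[-F(x_k)]\| .$$ Then the method is well defined for every choice of the $r_k$ and $d_k$: after any finite number of steps the current iterate lies in $\Omega$, admissible residuals exist, and for each of them the argmin is nonempty. Every sequence $\{x_k\}$ so generated satisfies $$\|T_{x_0}^{-1}[-F(x_k)]\|\le\Big(\frac{1+\theta^2}{2}\Big)^k b\qquad(k\ge 0),$$ is contained in $B(x_0,\lambda)$, and converges to a point $x_*\in B[x_0,\lambda]$, with $F(x_*)\in C$ if $x_*\in\Omega$. If moreover $2bL<1$, then $x_*\in\Omega$ (so $F(x_*)\in C$), $$\|x_k-x_{k+1}\|\le\frac{1+\theta}{1-\theta}\Big[\frac{1+\theta}{2}\,\frac{L}{1-s}\,\|x_{k-1}-x_k\|+\theta\,\frac{1+s}{1-s}\Big]\|x_{k-1}-x_k\|\qquad(k\ge 1),$$ and, with the ratio read as $0$ when $x_k=x_{k+1}=x_*$, $$\limsup_{k\to\infty}\frac{\|x_*-x_{k+1}\|}{\|x_*-x_k\|}\le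 q:=\frac{1+\theta}{1-\theta}\Big[\frac{1+\theta}{2}+\frac{2\theta}{1-s}\Big].$$ If in addition $\theta<\big(-2(2-s)+\sqrt{10bL-22s+21}\big)/(5-s)$, then $q<1$, so the convergence is $Q$-linear. -/

import Mathlib

open Set Filter Topology
open scoped ENNReal

namespace InexactNewton

section SetValued

variable {X Y Z : Type*}

/-- The domain `{d : T d ≠ ∅}` of a set-valued mapping. -/
def dom (T : X → Set Y) : Set X := {d | (T d).Nonempty}

/-- The range of a set-valued mapping. -/
def rge (T : X → Set Y) : Set Y := {y | ∃ d, y ∈ T d}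

/-- The inverse of a set-valued mapping. -/
def inv (T : X → Set Y) : Y → Set X := fun y => {d | y ∈ T d}

/-- `‖S‖ = inf {‖v‖ : v ∈ S}`, with value `+∞` for `S = ∅`. -/
noncomputable def setNorm [NormedAddCommGroup Y] (S : Set Y) : ℝ≥0∞ := ⨅ v ∈ S, ‖v‖ₑ

/-- The (inner) norm `sup {‖T d‖ : d ∈ dom T, ‖d‖ ≤ 1}` of a set-valued mapping. -/
noncomputable def innerNorm [NormedAddCommGroup X] [NormedAddCommGroup Y]
    (T : X → Set Y) : ℝ≥0∞ :=
  ⨆ d ∈ {d : X | d ∈ dom T ∧ ‖d‖ ≤ 1}, setNorm (T d)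

/-- The set of elements of least norm of `S`. -/
def argminNorm [NormedAddCommGroup X] (S : Set X) : Set X :=
  {d | d ∈ S ∧ ∀ d' ∈ S, ‖d‖ ≤ ‖d'‖}

end SetValued

/-- Reflexivity: the canonical embedding into the bidual is onto. -/
def IsReflexiveSpace (X : Type*) [NormedAddCommGroup X] [NormedSpace ℝ X] : Prop :=
  Function.Surjective (NormedSpace.inclusionInDoubleDual ℝ X)

section Newton

variable {X Y : Type*} [NormedAddCommGroup X] [NormedSpace ℝ X]
  [NormedAddCommGroup Y] [NormedSpace ℝ Y]

/-- The convex process `T_z d = F'(z) d - C`. -/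
noncomputable def process (F : X → Y) (C : ConvexCone ℝ Y) (z : X) : X → Set Y :=
  fun d => {y | ∃ c ∈ C, y = fderiv ℝ F z d - c}

/-- The inverse process `T_z⁻¹ y = {d : F'(z) d - y ∈ C}`. -/
noncomputable def processInv (F : X → Y) (C : ConvexCone ℝ Y) (z : X) : Y → Set X :=
  inv (process F C z)

theorem mem_processInv (F : X → Y) (C : ConvexCone ℝ Y) (z : X) (y : Y) (d : X) :
    d ∈ processInv F C z y ↔ fderiv ℝ F z d - y ∈ C := by
  constructor
  · rintro ⟨c, hc, h⟩
    rw [h, sub_sub_cancel]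
    exact hc
  · intro h
    exact ⟨_, h, by rw [sub_sub_cancel]⟩

/-- Robinson's condition at `x₀`: `rge T_{x₀} = Y`. -/
def RobinsonCondition (F : X → Y) (C : ConvexCone ℝ Y) (x₀ : X) : Prop :=
  rge (process F C x₀) = Set.univ

/-- The affine invariant Lipschitz condition at `x₀` with constant `L`. -/
def AffineLipschitz (F : X → Y) (C : ConvexCone ℝ Y) (Ω : Set X) (x₀ : X) (L : ℝ) : Prop :=
  Metric.ball x₀ (1 / L) ⊆ Ω ∧
    ∀ x ∈ Metric.ball x₀ (1 / L), ∀ y ∈ Metric.ball x₀ (1 / L),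
      innerNorm (fun d : X => processInv F C x₀ ((fderiv ℝ F y - fderiv ℝ F x) d)) ≤
        ENNReal.ofReal (L * ‖x - y‖)

/-- `r` satisfies the relative error criterion at the current iterate `x`:
`max_{w ∈ {-r, r}} ‖T_{x₀}⁻¹ w‖ ≤ θ ‖T_{x₀}⁻¹[-F(x)]‖`. -/
def AdmissibleResidual (F : X → Y) (C : ConvexCone ℝ Y) (x₀ : X) (θ : ℝ) (x : X) (r : Y) :
    Prop :=
  max (setNorm (processInv F C x₀ (-r))) (setNorm (processInv F C x₀ r)) ≤
    ENNReal.ofReal θ * setNorm (processInv F C x₀ (-F x))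

/-- The possible step directions at `x` for the residual `r`: the elements of least norm of
`{d : F(x) + F'(x) d + r ∈ C}`. -/
def stepDirections (F : X → Y) (C : ConvexCone ℝ Y) (x : X) (r : Y) : Set X :=
  argminNorm {d : X | F x + fderiv ℝ F x d + r ∈ C}

/-- `x'` is a possible inexact Newton iterate after `x`. -/
def IsStep (F : X → Y) (C : ConvexCone ℝ Y) (x₀ : X) (θ : ℝ) (x x' : X) : Prop :=
  ∃ r : Y, AdmissibleResidual F C x₀ θ x r ∧ ∃ d ∈ stepDirections F C x r, x' = x + d

/-- The first `n` steps of the sequence `x` are made by the inexact Newton method started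
at `x₀`. -/
def IsPartialRun (F : X → Y) (C : ConvexCone ℝ Y) (x₀ : X) (θ : ℝ) (n : ℕ) (x : ℕ → X) :
    Prop :=
  x 0 = x₀ ∧ ∀ k < n, IsStep F C x₀ θ (x k) (x (k + 1))

/-- `x` is a sequence generated by the inexact Newton method started at `x₀`. -/
def IsRun (F : X → Y) (C : ConvexCone ℝ Y) (x₀ : X) (θ : ℝ) (x : ℕ → X) : Prop :=
  x 0 = x₀ ∧ ∀ k, IsStep F C x₀ θ (x k) (x (k + 1))

end Newton

end InexactNewton

/-! Everything is measured by p(y) = ‖T_{x₀}⁻¹ y‖ (`leastNorm`). Robinson's condition makes p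
finite, reflexivity makes its infimum attained and p lower semicontinuous, and p is sublinear with
p(-c) = 0 on C. Hahn–Banach then yields a mean value inequality for p, and a Neumann-type series
solves the inclusion at every x with L‖x - x₀‖ < 1. With N_k = p(-F(x_k)), a step d satisfies ‖d‖ ≤
(1+θ)N_k/(1 - L‖x_k - x₀‖) and N_{k+1} ≤ (L/2)‖d‖² + θN_k. The scalar iteration t ↦ t + (1+θ)f(t)/(1
- Lt), with f(t) = b - at + Lt²/2 and a = (1-θ)/(1+θ), dominates both quantities: ‖x_k - x₀‖ ≤ t_k
and N_k ≤ f(t_k). The condition on θ says s ≤ a, hence f(s/L) ≤ 0, which keeps L t_k < s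
(`region_step`). This gives well-definedness and convergence; `residual_decrease` gives the residual
rate. For the Q-linear rate, the tail after x_{k+1} is geometric with a ratio tending to θ, while
N_k is at most (1+s+o(1)) times the distance from x_k to the limit. -/

namespace InexactNewton

/-! ### Weak compactness and least-norm elements -/

section Reflexive

variable {X : Type*} [NormedAddCommGroup X] [NormedSpace ℝ X]

/-- Bounded closed convex subsets of a reflexive space are weakly compact. -/
theorem isCompact_toWeakSpace_image (hX : IsReflexiveSpace X) {S : Set X} (hc : Convex ℝ S)
    (hcl : IsClosed S) (hb : Bornology.IsBounded S) : IsCompact (toWeakSpace ℝ X '' S) := by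
  have h := NormedSpace.isCompact_closure_of_isBounded ℝ X (toWeakSpace ℝ X '' S)
    (by rwa [preimage_image_eq _ (toWeakSpace ℝ X).injective])
    (fun ξ _ => by
      obtain ⟨x, hx⟩ := hX (WeakDual.toStrongDual ξ)
      refine ⟨toWeakSpace ℝ X x, ?_⟩
      exact DFunLike.ext _ _ fun f => DFunLike.congr_fun hx f)
  -- Mazur: for a convex set the norm closure and the weak closure agree.
  rwa [← hc.toWeakSpace_closure ℝ, hcl.closure_eq] at h

/-- Decreasing sequences of nonempty bounded closed convex subsets of a reflexive space have a
common point. -/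
theorem nonempty_iInter_of_convex (hX : IsReflexiveSpace X) (S : ℕ → Set X)
    (hanti : ∀ n, S (n + 1) ⊆ S n) (hne : ∀ n, (S n).Nonempty) (hc : ∀ n, Convex ℝ (S n))
    (hcl : ∀ n, IsClosed (S n)) (hb : Bornology.IsBounded (S 0)) : (⋂ n, S n).Nonempty := by
  obtain ⟨w, hw⟩ := IsCompact.nonempty_iInter_of_sequence_nonempty_isCompact_isClosed
    (fun n => toWeakSpace ℝ X '' S n) (fun n => image_mono (hanti n))
    (fun n => (hne n).image _) (isCompact_toWeakSpace_image hX (hc 0) (hcl 0) hb)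
    (fun n => by
      have h := (hc n).toWeakSpace_closure ℝ
      rw [(hcl n).closure_eq] at h
      rw [h]
      exact isClosed_closure)
  refine ⟨(toWeakSpace ℝ X).symm w, mem_iInter.2 fun n => ?_⟩
  obtain ⟨x, hx, rfl⟩ := mem_iInter.1 hw n
  simpa using hx

/-- In a reflexive space, nonempty closed convex sets have elements of least norm. -/
theorem argminNorm_nonempty (hX : IsReflexiveSpace X) {S : Set X} (hne : S.Nonempty)
    (hc : Convex ℝ S) (hcl : IsClosed S) : (argminNorm S).Nonempty := by
  set r := Metric.infDist 0 S with hr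
  have hpos : ∀ n : ℕ, (0 : ℝ) < 1 / (n + 1) := fun n => by positivity
  obtain ⟨d, hd⟩ := nonempty_iInter_of_convex hX
    (fun n : ℕ => S ∩ Metric.closedBall 0 (r + 1 / (n + 1)))
    (fun n => inter_subset_inter_right _ (Metric.closedBall_subset_closedBall (by
      have : (1 : ℝ) / ((n : ℝ) + 1 + 1) ≤ 1 / (n + 1) :=
        one_div_le_one_div_of_le (by positivity) (by linarith)
      push_cast
      linarith)))
    (fun n => by
      obtain ⟨y, hy, hlt⟩ := (Metric.infDist_lt_iff (x := (0 : X)) hne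
        (r := r + 1 / (n + 1))).1 (by linarith [hpos n])
      exact ⟨y, hy, by rw [Metric.mem_closedBall, dist_comm]; exact hlt.le⟩)
    (fun n => hc.inter (convex_closedBall _ _))
    (fun n => hcl.inter Metric.isClosed_closedBall)
    (Metric.isBounded_closedBall.subset inter_subset_right)
  rw [mem_iInter] at hd
  refine ⟨d, (hd 0).1, fun d' hd' => ?_⟩
  have h1 : ‖d‖ ≤ r := by
    refine le_of_forall_pos_lt_add fun ε hε => ?_
    obtain ⟨n, hn⟩ := exists_nat_one_div_lt hε
    have := (hd n).2
    rw [mem_closedBall_zero_iff] at this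
    linarith
  have h2 : r ≤ ‖d'‖ := by
    have := Metric.infDist_le_dist_of_mem (x := (0 : X)) hd'
    rwa [dist_zero_left] at this
  exact h1.trans h2

end Reflexive

/-! ### The sublinear functional y ↦ ‖T⁻¹ y‖ -/

section LeastNorm

variable {X Y : Type*} [NormedAddCommGroup X] [NormedSpace ℝ X]
  [NormedAddCommGroup Y] [NormedSpace ℝ Y]

/-- The least norm of the solutions `d` of `A d - y ∈ C`. -/
noncomputable def leastNorm (A : X →L[ℝ] Y) (C : ConvexCone ℝ Y) (y : Y) : ℝ :=
  sInf (norm '' {d | A d - y ∈ C})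

variable {A : X →L[ℝ] Y} {C : ConvexCone ℝ Y}

theorem leastNorm_nonneg (y : Y) : 0 ≤ leastNorm A C y :=
  Real.sInf_nonneg (by rintro _ ⟨d, -, rfl⟩; exact norm_nonneg d)

theorem leastNorm_le {y : Y} {d : X} (h : A d - y ∈ C) : leastNorm A C y ≤ ‖d‖ :=
  csInf_le ⟨0, by rintro _ ⟨d, -, rfl⟩; exact norm_nonneg d⟩ ⟨d, h, rfl⟩

theorem leastNorm_eq_of_mem_argminNorm {y : Y} {d : X} (h : d ∈ argminNorm {d | A d - y ∈ C}) :
    leastNorm A C y = ‖d‖ :=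
  le_antisymm (leastNorm_le h.1)
    (le_csInf ⟨_, d, h.1, rfl⟩ (by rintro _ ⟨d', hd', rfl⟩; exact h.2 d' hd'))

/-- A `ConvexCone` is closed under positive multiples only, so 0 is obtained as the limit of
c/(n+1). -/
theorem zero_mem_of_isClosed (hne : (C : Set Y).Nonempty) (hcl : IsClosed (C : Set Y)) :
    (0 : Y) ∈ C := by
  obtain ⟨c, hc⟩ := hne
  have h : Tendsto (fun n : ℕ => (1 / ((n : ℝ) + 1)) • c) atTop (𝓝 ((0 : ℝ) • c)) :=
    tendsto_one_div_add_atTop_nhds_zero_nat.smul_const c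
  rw [zero_smul] at h
  exact hcl.mem_of_tendsto h (Eventually.of_forall fun n => C.smul_mem (by positivity) hc)

theorem convex_solutions (y : Y) : Convex ℝ {d | A d - y ∈ C} := by
  intro d hd d' hd' a b ha hb hab
  have h := C.convex hd hd' ha hb hab
  have e : a • (A d - y) + b • (A d' - y) = A (a • d + b • d') - y := by
    have : y = (a + b) • y := by rw [hab, one_smul]
    rw [map_add, map_smul, map_smul]
    nth_rw 3 [this]
    module
  rw [e] at h
  exact h

theorem isClosed_solutions (hcl : IsClosed (C : Set Y)) (y : Y) : IsClosed {d | A d - y ∈ C} :=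
  hcl.preimage (by fun_prop : Continuous fun d => A d - y)

theorem exists_leastNorm (hX : IsReflexiveSpace X) (hcl : IsClosed (C : Set Y)) {y : Y}
    (hne : ∃ d, A d - y ∈ C) : ∃ d, A d - y ∈ C ∧ ‖d‖ = leastNorm A C y := by
  obtain ⟨d, hd⟩ := argminNorm_nonempty hX hne (convex_solutions y) (isClosed_solutions hcl y)
  exact ⟨d, hd.1, (leastNorm_eq_of_mem_argminNorm hd).symm⟩

theorem leastNorm_zero (h0 : (0 : Y) ∈ C) : leastNorm A C 0 = 0 :=
  le_antisymm (by simpa using leastNorm_le (A := A) (C := C) (y := 0) (d := 0) (by simpa using h0))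
    (leastNorm_nonneg 0)

theorem leastNorm_neg_of_mem {c : Y} (hc : c ∈ C) : leastNorm A C (-c) = 0 :=
  le_antisymm (by simpa using leastNorm_le (A := A) (C := C) (y := -c) (d := 0) (by simpa using hc))
    (leastNorm_nonneg _)

/-- The sum of two minimizers is feasible for the sum. Solvability excludes the default value `sInf
∅ = 0`. -/
theorem leastNorm_add_le (hX : IsReflexiveSpace X) (hcl : IsClosed (C : Set Y))
    (hs : ∀ y, ∃ d, A d - y ∈ C) (u v : Y) :
    leastNorm A C (u + v) ≤ leastNorm A C u + leastNorm A C v := by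
  obtain ⟨d, hd, hdn⟩ := exists_leastNorm hX hcl (hs u)
  obtain ⟨e, he, hen⟩ := exists_leastNorm hX hcl (hs v)
  rw [← hdn, ← hen]
  refine (leastNorm_le (d := d + e) ?_).trans (norm_add_le _ _)
  have := C.add_mem hd he
  rwa [show A d - u + (A e - v) = A (d + e) - (u + v) by rw [map_add]; abel] at this

theorem leastNorm_smul_le (hX : IsReflexiveSpace X) (hcl : IsClosed (C : Set Y))
    (hs : ∀ y, ∃ d, A d - y ∈ C) {t : ℝ} (ht : 0 < t) (y : Y) :
    leastNorm A C (t • y) ≤ t * leastNorm A C y := by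
  obtain ⟨d, hd, hdn⟩ := exists_leastNorm hX hcl (hs y)
  rw [← hdn, ← Real.norm_of_nonneg ht.le, ← norm_smul, Real.norm_of_nonneg ht.le]
  refine leastNorm_le ?_
  have := C.smul_mem ht hd
  rwa [smul_sub, ← map_smul] at this

/-- Lower semicontinuity, by weak compactness: points of the sublevel set near y supply d in a fixed
ball with A d - y ever closer to C. These d fill nested closed convex bounded sets, and a common
point solves the problem for y. -/
theorem isClosed_leastNorm_le (hX : IsReflexiveSpace X) (hcl : IsClosed (C : Set Y))
    (hs : ∀ y, ∃ d, A d - y ∈ C) (c : ℝ) : IsClosed {y | leastNorm A C y ≤ c} := by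
  refine isClosed_of_closure_subset fun y hy => ?_
  have hC : Convex ℝ (C : Set Y) := C.convex
  have hpos : ∀ n : ℕ, (0 : ℝ) < 1 / (n + 1) := fun n => by positivity
  obtain ⟨d, hd⟩ := nonempty_iInter_of_convex hX
    (fun n : ℕ => Metric.closedBall 0 c ∩
      {d | A d - y ∈ Metric.cthickening (1 / ((n : ℝ) + 1)) (C : Set Y)})
    (fun n => inter_subset_inter_right _ fun d hd => Metric.cthickening_mono (by
      push_cast
      exact one_div_le_one_div_of_le (by positivity) (by linarith)) _ hd)
    (fun n => by
      obtain ⟨y', hy', hyy⟩ := Metric.mem_closure_iff.1 hy _ (hpos n)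
      obtain ⟨d, hd, hdn⟩ := exists_leastNorm hX hcl (hs y')
      refine ⟨d, by rw [mem_closedBall_zero_iff, hdn]; exact hy', ?_⟩
      refine Metric.mem_cthickening_of_dist_le _ _ _ _ hd ?_
      rw [dist_sub_left]
      exact hyy.le)
    (fun n => (convex_closedBall _ _).inter (by
      intro d hd d' hd' a b ha hb hab
      have h := hC.cthickening (1 / ((n : ℝ) + 1)) hd hd' ha hb hab
      have e : a • (A d - y) + b • (A d' - y) = A (a • d + b • d') - y := by
        have : y = (a + b) • y := by rw [hab, one_smul]
        rw [map_add, map_smul, map_smul]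
        nth_rw 3 [this]
        module
      rw [e] at h
      exact h))
    (fun n => Metric.isClosed_closedBall.inter
      (Metric.isClosed_cthickening.preimage (by fun_prop : Continuous fun d => A d - y)))
    (Metric.isBounded_closedBall.subset inter_subset_left)
  rw [mem_iInter] at hd
  have hmem : A d - y ∈ C := by
    have : A d - y ∈ closure (C : Set Y) := by
      rw [Metric.closure_eq_iInter_cthickening]
      refine mem_iInter₂.2 fun ε hε => ?_
      obtain ⟨n, hn⟩ := exists_nat_one_div_lt hε
      exact Metric.cthickening_mono hn.le _ (hd n).2
    rwa [hcl.closure_eq] at this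
  exact (leastNorm_le hmem).trans (mem_closedBall_zero_iff.1 (hd 0).1)

theorem convex_leastNorm_le (hX : IsReflexiveSpace X) (hcl : IsClosed (C : Set Y))
    (hs : ∀ y, ∃ d, A d - y ∈ C) (c : ℝ) : Convex ℝ {y | leastNorm A C y ≤ c} := by
  refine convex_iff_forall_pos.2 fun u hu v hv a b ha hb hab => ?_
  have h := leastNorm_add_le hX hcl hs (a • u) (b • v)
  have h1 := leastNorm_smul_le hX hcl hs ha u
  have h2 := leastNorm_smul_le hX hcl hs hb v
  have h3 : a * leastNorm A C u ≤ a * c := mul_le_mul_of_nonneg_left hu ha.le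
  have h4 : b * leastNorm A C v ≤ b * c := mul_le_mul_of_nonneg_left hv hb.le
  show _ ≤ c
  calc _ ≤ a * c + b * c := by linarith
    _ = c := by rw [← add_mul, hab, one_mul]

/-- A value of `leastNorm` above `c` is detected by a functional dominated by `leastNorm`. -/
theorem exists_functional_of_lt_leastNorm (hX : IsReflexiveSpace X) (hcl : IsClosed (C : Set Y))
    (hs : ∀ y, ∃ d, A d - y ∈ C) {c : ℝ} (hc : 0 ≤ c) {y : Y} (hy : c < leastNorm A C y) :
    ∃ f : StrongDual ℝ Y, (∀ z, f z ≤ leastNorm A C z) ∧ c < f y := by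
  obtain ⟨c', hcc, hc'⟩ := exists_between hy
  have hc0 : 0 < c' := hc.trans_lt hcc
  obtain ⟨f, u, hf, hu⟩ := geometric_hahn_banach_closed_point (convex_leastNorm_le hX hcl hs c')
    (isClosed_leastNorm_le hX hcl hs c') (x := y) (by simpa using hc')
  have hu0 : 0 < u := by
    obtain ⟨d, hd⟩ := hs 0
    have h0 : leastNorm A C (0 : Y) ≤ c' := by
      have h := leastNorm_smul_le hX hcl hs (show (0 : ℝ) < 1 / 2 by norm_num) (0 : Y)
      rw [smul_zero] at h
      linarith
    simpa using hf 0 h0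
  have key : ∀ z, f z ≤ u / c' * leastNorm A C z := by
    intro z
    refine le_of_forall_pos_le_add fun ε hε => ?_
    -- The ε-term keeps m positive when `leastNorm A C z` vanishes, so z can be scaled into the
    -- sublevel set; it contributes exactly ε to the final bound.
    set m := leastNorm A C z + ε * c' / u with hm
    have hm0 : 0 < m := add_pos_of_nonneg_of_pos (leastNorm_nonneg z) (by positivity)
    have h1 : leastNorm A C ((c' / m) • z) ≤ c' := by
      refine (leastNorm_smul_le hX hcl hs (by positivity) z).trans ?_
      rw [div_mul_eq_mul_div, div_le_iff₀ hm0]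
      refine mul_le_mul_of_nonneg_left ?_ hc0.le
      rw [hm]
      have : 0 ≤ ε * c' / u := by positivity
      linarith
    have h2 := hf _ h1
    rw [map_smul, smul_eq_mul, div_mul_eq_mul_div, div_lt_iff₀ hm0] at h2
    have h3 : f z ≤ u * m / c' := by
      rw [le_div_iff₀ hc0]; linarith
    refine h3.trans (le_of_eq ?_)
    rw [hm]
    field_simp
  refine ⟨(c' / u) • f, fun z => ?_, ?_⟩
  · have := mul_le_mul_of_nonneg_left (key z) (by positivity : 0 ≤ c' / u)
    calc ((c' / u) • f) z = c' / u * f z := rfl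
      _ ≤ c' / u * (u / c' * leastNorm A C z) := this
      _ = leastNorm A C z := by field_simp
  · calc c < c' := hcc
      _ = c' / u * u := by field_simp
      _ ≤ c' / u * f y := mul_le_mul_of_nonneg_left hu.le (by positivity)
      _ = ((c' / u) • f) y := rfl

end LeastNorm

section SetNorm

variable {X : Type*} [NormedAddCommGroup X]

theorem setNorm_eq_ofReal {S : Set X} {d : X} (hd : d ∈ argminNorm S) :
    setNorm S = ENNReal.ofReal ‖d‖ := by
  rw [ofReal_norm]
  refine le_antisymm (iInf₂_le d hd.1) (le_iInf₂ fun v hv => ?_)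
  rw [← ofReal_norm, ← ofReal_norm]
  exact ENNReal.ofReal_le_ofReal (hd.2 v hv)

end SetNorm

/-! ### Perturbation lemma and mean value inequality -/

section Perturbation

variable {X Y : Type*} [NormedAddCommGroup X] [NormedSpace ℝ X]
  [NormedAddCommGroup Y] [NormedSpace ℝ Y] {A : X →L[ℝ] Y} {C : ConvexCone ℝ Y}

/-- Banach's perturbation lemma for the convex process `d ↦ A d - C`. -/
theorem exists_solution_of_perturbation [CompleteSpace X] (hX : IsReflexiveSpace X)
    (hcl : IsClosed (C : Set Y)) (hs : ∀ y, ∃ d, A d - y ∈ C) {B : X →L[ℝ] Y} {ρ : ℝ}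
    (hρ0 : 0 ≤ ρ) (hρ1 : ρ < 1) (hB : ∀ d, leastNorm A C ((A - B) d) ≤ ρ * ‖d‖) (y : Y) :
    ∃ d, B d - y ∈ C ∧ ‖d‖ ≤ leastNorm A C y / (1 - ρ) := by
  choose m hm hmn using fun y => exists_leastNorm hX hcl (hs y)
  -- Neumann-type series: each term corrects, modulo C, the error (A - B) d_n left by its
  -- predecessor.
  let d : ℕ → X := fun n => Nat.rec (m y) (fun _ e => m ((A - B) e)) n
  have d0 : d 0 = m y := rfl
  have dS : ∀ n, d (n + 1) = m ((A - B) (d n)) := fun n => rfl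
  have hbound : ∀ n, ‖d n‖ ≤ leastNorm A C y * ρ ^ n := by
    intro n
    induction n with
    | zero => rw [d0, hmn]; simp
    | succ n ih =>
      rw [dS, hmn]
      refine (hB _).trans ?_
      calc ρ * ‖d n‖ ≤ ρ * (leastNorm A C y * ρ ^ n) := mul_le_mul_of_nonneg_left ih hρ0
        _ = _ := by ring
  have hsum := (hasSum_geometric_of_lt_one hρ0 hρ1).mul_left (leastNorm A C y)
  have hd : Summable d := Summable.of_norm_bounded hsum.summable hbound
  -- The inclusions telescope under addition in C, leaving the defect (B - A) d_n, which tends to 0.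
  have hpart : ∀ n, B (∑ i ∈ Finset.range (n + 1), d i) - y - (B - A) (d n) ∈ C := by
    intro n
    induction n with
    | zero =>
      have := hm y
      rw [← d0] at this
      have e : B (∑ i ∈ Finset.range (0 + 1), d i) - y - (B - A) (d 0) = A (d 0) - y := by
        simp
      rwa [e]
    | succ n ih =>
      have h := hm ((A - B) (d n))
      rw [← dS] at h
      have := C.add_mem ih h
      rw [Finset.sum_range_succ, map_add]
      convert this using 1
      simp only [sub_apply]
      abel
  refine ⟨∑' n, d n, ?_, ?_⟩
  · have h1 : Tendsto (fun n => ∑ i ∈ Finset.range (n + 1), d i) atTop (𝓝 (∑' n, d n)) :=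
      (tendsto_add_atTop_iff_nat 1).2 hd.hasSum.tendsto_sum_nat
    have h2 : Tendsto (fun n => B (∑ i ∈ Finset.range (n + 1), d i) - y - (B - A) (d n)) atTop
        (𝓝 (B (∑' n, d n) - y - (B - A) 0)) :=
      (((B.continuous.tendsto _).comp h1).sub_const y).sub
        (((B - A).continuous.tendsto _).comp hd.tendsto_atTop_zero)
    rw [map_zero, sub_zero] at h2
    exact hcl.mem_of_tendsto h2 (Eventually.of_forall hpart)
  · rw [div_eq_mul_inv]
    exact tsum_of_norm_bounded hsum hbound

/-- Mean value inequality for `leastNorm`. -/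
theorem leastNorm_sub_le_of_deriv (hX : IsReflexiveSpace X) (hcl : IsClosed (C : Set Y))
    (hs : ∀ y, ∃ d, A d - y ∈ C) {g g' : ℝ → Y} {K : ℝ} (hK : 0 ≤ K)
    (hg : ∀ t ∈ Icc (0 : ℝ) 1, HasDerivAt g (g' t) t)
    (hg' : ∀ t ∈ Icc (0 : ℝ) 1, leastNorm A C (g' t) ≤ K * t) :
    leastNorm A C (g 1 - g 0) ≤ K / 2 := by
  by_contra! hlt
  -- A functional dominated by `leastNorm` reduces the claim to the monotonicity of the scalar
  -- function f(g(t)) - K t²/2.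
  obtain ⟨f, hf, hfy⟩ := exists_functional_of_lt_leastNorm hX hcl hs (by positivity) hlt
  have hder : ∀ t ∈ Icc (0 : ℝ) 1,
      HasDerivAt (fun t => f (g t) - K / 2 * t ^ 2) (f (g' t) - K * t) t := fun t ht => by
    have h1 := f.hasFDerivAt.comp_hasDerivAt t (hg t ht)
    have h2 : HasDerivAt (fun t : ℝ => K / 2 * t ^ 2) (K * t) t := by
      have := (hasDerivAt_pow 2 t).const_mul (K / 2)
      rwa [show K / 2 * (((2 : ℕ) : ℝ) * t ^ (2 - 1)) = K * t by norm_num; ring] at this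
    exact h1.sub h2
  have hanti : AntitoneOn (fun t => f (g t) - K / 2 * t ^ 2) (Icc 0 1) := by
    refine antitoneOn_of_deriv_nonpos (convex_Icc 0 1)
      (fun t ht => (hder t ht).continuousAt.continuousWithinAt) (fun t ht => ?_) (fun t ht => ?_)
    · exact (hder t (interior_subset ht)).differentiableAt.differentiableWithinAt
    · rw [(hder t (interior_subset ht)).deriv]
      linarith [hf (g' t), hg' t (interior_subset ht)]
  have := hanti (left_mem_Icc.2 zero_le_one) (right_mem_Icc.2 zero_le_one) zero_le_one
  rw [map_sub] at hfy
  simp only at this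
  linarith

theorem setNorm_processInv (hX : IsReflexiveSpace X) (hcl : IsClosed (C : Set Y)) {F : X → Y}
    {z : X} {y : Y} (hs : ∃ d, fderiv ℝ F z d - y ∈ C) :
    setNorm (processInv F C z y) = ENNReal.ofReal (leastNorm (fderiv ℝ F z) C y) := by
  have e : processInv F C z y = {d | fderiv ℝ F z d - y ∈ C} :=
    Set.ext fun d => mem_processInv F C z y d
  obtain ⟨d, hd⟩ := argminNorm_nonempty hX (S := {d | fderiv ℝ F z d - y ∈ C}) hs
    (convex_solutions y) (isClosed_solutions hcl y)
  rw [e, setNorm_eq_ofReal hd, leastNorm_eq_of_mem_argminNorm hd]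

theorem RobinsonCondition.exists_solution {F : X → Y} {x₀ : X} (h : RobinsonCondition F C x₀)
    (y : Y) : ∃ d, fderiv ℝ F x₀ d - y ∈ C := by
  have : y ∈ rge (process F C x₀) := by
    rw [show rge (process F C x₀) = univ from h]
    trivial
  obtain ⟨d, c, hc, hy⟩ := this
  exact ⟨d, by rw [hy, sub_sub_cancel]; exact hc⟩

/-- The inner norm only tests the unit ball; positive homogeneity extends the bound to all d, and
solvability puts every d in the domain. -/
theorem AffineLipschitz.leastNorm_le (hX : IsReflexiveSpace X) (hcl : IsClosed (C : Set Y))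
    (h0 : (0 : Y) ∈ C) {F : X → Y} {x₀ : X} {Ω : Set X} {L : ℝ} (hL : 0 ≤ L)
    (hs : ∀ y, ∃ d, fderiv ℝ F x₀ d - y ∈ C) (h : AffineLipschitz F C Ω x₀ L) {x y : X}
    (hx : x ∈ Metric.ball x₀ (1 / L)) (hy : y ∈ Metric.ball x₀ (1 / L)) (d : X) :
    leastNorm (fderiv ℝ F x₀) C ((fderiv ℝ F y - fderiv ℝ F x) d) ≤ L * ‖x - y‖ * ‖d‖ := by
  rcases eq_or_ne d 0 with rfl | hd
  · simp [leastNorm_zero h0]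
  have hd0 : 0 < ‖d‖ := norm_pos_iff.2 hd
  set u := ‖d‖⁻¹ • d with hu
  have hdu : d = ‖d‖ • u := by rw [hu, smul_smul, mul_inv_cancel₀ hd0.ne', one_smul]
  have hun : ‖u‖ ≤ 1 := by
    rw [hu, norm_smul, norm_inv, norm_norm, inv_mul_cancel₀ hd0.ne']
  have hU : leastNorm (fderiv ℝ F x₀) C ((fderiv ℝ F y - fderiv ℝ F x) u) ≤ L * ‖x - y‖ := by
    have h2 := h.2 x hx y hy
    have h1 : setNorm (processInv F C x₀ ((fderiv ℝ F y - fderiv ℝ F x) u)) ≤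
        innerNorm (fun d : X => processInv F C x₀ ((fderiv ℝ F y - fderiv ℝ F x) d)) := by
      refine le_iSup₂ (f := fun (d : X) (_ : d ∈ {d : X | d ∈ dom (fun d : X =>
        processInv F C x₀ ((fderiv ℝ F y - fderiv ℝ F x) d)) ∧ ‖d‖ ≤ 1}) =>
        setNorm (processInv F C x₀ ((fderiv ℝ F y - fderiv ℝ F x) d))) u ⟨?_, hun⟩
      obtain ⟨e, he⟩ := hs ((fderiv ℝ F y - fderiv ℝ F x) u)
      exact ⟨e, (mem_processInv F C x₀ _ e).2 he⟩
    have h3 := h1.trans h2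
    rw [setNorm_processInv hX hcl (hs _)] at h3
    exact (ENNReal.ofReal_le_ofReal_iff (by positivity)).1 h3
  rw [hdu, map_smul]
  refine (leastNorm_smul_le hX hcl hs hd0 _).trans ?_
  rw [← hdu, mul_comm]
  exact mul_le_mul_of_nonneg_right hU hd0.le

end Perturbation

/-! ### Estimates for one Newton step near x₀ -/

section LocalEstimates

variable {X Y : Type*} [NormedAddCommGroup X] [NormedSpace ℝ X]
  [NormedAddCommGroup Y] [NormedSpace ℝ Y]

/-- The standing assumptions on `F` near `x₀`, expressed through `leastNorm`. -/
structure LocalAssumptions (F : X → Y) (C : ConvexCone ℝ Y) (x₀ : X) (L : ℝ) : Prop where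
  reflexive : IsReflexiveSpace X
  isClosed : IsClosed (C : Set Y)
  zero_mem : (0 : Y) ∈ C
  pos : 0 < L
  solvable : ∀ y, ∃ d, fderiv ℝ F x₀ d - y ∈ C
  differentiableAt : ∀ x ∈ Metric.ball x₀ (1 / L), DifferentiableAt ℝ F x
  lipschitz : ∀ x ∈ Metric.ball x₀ (1 / L), ∀ y ∈ Metric.ball x₀ (1 / L), ∀ d,
    leastNorm (fderiv ℝ F x₀) C ((fderiv ℝ F y - fderiv ℝ F x) d) ≤ L * ‖x - y‖ * ‖d‖

/-- `‖T_{x₀}⁻¹ y‖` as a real number. -/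
noncomputable abbrev baseNorm (F : X → Y) (C : ConvexCone ℝ Y) (x₀ : X) (y : Y) : ℝ :=
  leastNorm (fderiv ℝ F x₀) C y

namespace LocalAssumptions

variable {F : X → Y} {C : ConvexCone ℝ Y} {x₀ : X} {L : ℝ} (H : LocalAssumptions F C x₀ L)

include H

theorem mul_norm_sub_lt_one {x : X} (hx : x ∈ Metric.ball x₀ (1 / L)) : L * ‖x - x₀‖ < 1 := by
  rw [mem_ball_iff_norm, lt_div_iff₀ H.pos] at hx
  linarith

theorem baseNorm_add_le (u v : Y) :
    baseNorm F C x₀ (u + v) ≤ baseNorm F C x₀ u + baseNorm F C x₀ v :=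
  leastNorm_add_le H.reflexive H.isClosed H.solvable u v

theorem exists_solution [CompleteSpace X] {x : X} (hx : x ∈ Metric.ball x₀ (1 / L)) (y : Y) :
    ∃ d, fderiv ℝ F x d - y ∈ C ∧ ‖d‖ ≤ baseNorm F C x₀ y / (1 - L * ‖x - x₀‖) :=
  exists_solution_of_perturbation H.reflexive H.isClosed H.solvable
    (mul_nonneg H.pos.le (norm_nonneg _)) (H.mul_norm_sub_lt_one hx)
    (fun d => H.lipschitz x hx x₀ (Metric.mem_ball_self (one_div_pos.2 H.pos)) d) y

theorem baseNorm_fderiv_le {x : X} (hx : x ∈ Metric.ball x₀ (1 / L)) (d : X) :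
    baseNorm F C x₀ (fderiv ℝ F x d) ≤ (1 + L * ‖x - x₀‖) * ‖d‖ := by
  have h1 := H.baseNorm_add_le (fderiv ℝ F x₀ d) ((fderiv ℝ F x - fderiv ℝ F x₀) d)
  have h2 : baseNorm F C x₀ (fderiv ℝ F x₀ d) ≤ ‖d‖ :=
    leastNorm_le (by rw [sub_self]; exact H.zero_mem)
  have h3 := H.lipschitz x₀ (Metric.mem_ball_self (one_div_pos.2 H.pos)) x hx d
  rw [norm_sub_rev] at h3
  have e : fderiv ℝ F x₀ d + (fderiv ℝ F x - fderiv ℝ F x₀) d = fderiv ℝ F x d := by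
    simp
  rw [e] at h1
  linarith

theorem hasDerivAt_remainder {x d : X} (hx : x ∈ Metric.ball x₀ (1 / L))
    (hxd : x + d ∈ Metric.ball x₀ (1 / L)) {t : ℝ} (ht : t ∈ Icc (0 : ℝ) 1) :
    x + t • d ∈ Metric.ball x₀ (1 / L) ∧
    HasDerivAt (fun t : ℝ => F (x + t • d) - t • fderiv ℝ F x d)
      ((fderiv ℝ F (x + t • d) - fderiv ℝ F x) d) t := by
  have hmem : x + t • d ∈ Metric.ball x₀ (1 / L) :=
    (convex_ball x₀ (1 / L)).add_smul_mem hx hxd ht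
  refine ⟨hmem, ?_⟩
  have h1 : HasDerivAt (fun t : ℝ => x + t • d) d t := by
    simpa using ((hasDerivAt_id t).smul_const d).const_add x
  have h2 := (H.differentiableAt _ hmem).hasFDerivAt.comp_hasDerivAt t h1
  have h3 : HasDerivAt (fun t : ℝ => t • fderiv ℝ F x d) (fderiv ℝ F x d) t := by
    simpa using (hasDerivAt_id t).smul_const (fderiv ℝ F x d)
  exact h2.sub h3

theorem baseNorm_remainder_le {x d : X} (hx : x ∈ Metric.ball x₀ (1 / L))
    (hxd : x + d ∈ Metric.ball x₀ (1 / L)) :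
    baseNorm F C x₀ (F (x + d) - F x - fderiv ℝ F x d) ≤ L / 2 * ‖d‖ ^ 2 := by
  have h := leastNorm_sub_le_of_deriv H.reflexive H.isClosed H.solvable
    (K := L * ‖d‖ ^ 2) (mul_nonneg H.pos.le (sq_nonneg _))
    (fun t ht => (H.hasDerivAt_remainder hx hxd ht).2)
    (fun t ht => by
      refine (H.lipschitz _ hx _ (H.hasDerivAt_remainder hx hxd ht).1 d).trans (le_of_eq ?_)
      rw [sub_add_cancel_left, norm_neg, norm_smul, Real.norm_of_nonneg ht.1]
      ring)
  simp only [one_smul, zero_smul, add_zero, sub_zero] at h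
  rw [sub_right_comm] at h
  exact h.trans (le_of_eq (by ring))

/-- Needed separately because `baseNorm` is not symmetric. Swapping the two points in the Lipschitz
condition handles the sign. -/
theorem baseNorm_neg_remainder_le {x d : X} (hx : x ∈ Metric.ball x₀ (1 / L))
    (hxd : x + d ∈ Metric.ball x₀ (1 / L)) :
    baseNorm F C x₀ (-(F (x + d) - F x - fderiv ℝ F x d)) ≤ L / 2 * ‖d‖ ^ 2 := by
  have h := leastNorm_sub_le_of_deriv H.reflexive H.isClosed H.solvable
    (K := L * ‖d‖ ^ 2) (mul_nonneg H.pos.le (sq_nonneg _))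
    (fun t ht => (H.hasDerivAt_remainder hx hxd ht).2.neg)
    (fun t ht => by
      rw [← neg_apply, neg_sub]
      refine (H.lipschitz _ (H.hasDerivAt_remainder hx hxd ht).1 _ hx d).trans (le_of_eq ?_)
      rw [add_sub_cancel_left, norm_smul, Real.norm_of_nonneg ht.1]
      ring)
  simp only [Pi.neg_apply, one_smul, zero_smul, add_zero, sub_zero] at h
  rw [← neg_sub', sub_right_comm] at h
  exact h.trans (le_of_eq (by ring))

/-- The new residual splits as minus the Taylor remainder, minus an element of C (which costs
nothing), plus r. -/
theorem baseNorm_neg_add_le {x d : X} {r : Y} (hx : x ∈ Metric.ball x₀ (1 / L))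
    (hxd : x + d ∈ Metric.ball x₀ (1 / L)) (hd : F x + fderiv ℝ F x d + r ∈ C) :
    baseNorm F C x₀ (-F (x + d)) ≤ L / 2 * ‖d‖ ^ 2 + baseNorm F C x₀ r := by
  have h1 := H.baseNorm_add_le (-(F (x + d) - F x - fderiv ℝ F x d))
    (-(F x + fderiv ℝ F x d + r) + r)
  have h2 := H.baseNorm_add_le (-(F x + fderiv ℝ F x d + r)) r
  have h3 : baseNorm F C x₀ (-(F x + fderiv ℝ F x d + r)) = 0 := leastNorm_neg_of_mem hd
  have h4 := H.baseNorm_neg_remainder_le hx hxd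
  have e : -(F (x + d) - F x - fderiv ℝ F x d) + (-(F x + fderiv ℝ F x d + r) + r) =
    -F (x + d) := by abel
  rw [e] at h1
  linarith

theorem stepDirections_nonempty [CompleteSpace X] {x : X} (hx : x ∈ Metric.ball x₀ (1 / L))
    (r : Y) : (stepDirections F C x r).Nonempty := by
  have e : {d : X | F x + fderiv ℝ F x d + r ∈ C} = {d | fderiv ℝ F x d - (-F x - r) ∈ C} := by
    ext d
    simp only [mem_ofPred_eq]
    rw [show F x + fderiv ℝ F x d + r = fderiv ℝ F x d - (-F x - r) by abel]
  obtain ⟨d, hd, -⟩ := H.exists_solution hx (-F x - r)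
  rw [stepDirections, e]
  exact argminNorm_nonempty H.reflexive ⟨d, hd⟩ (convex_solutions _)
    (isClosed_solutions H.isClosed _)

/-- The perturbation lemma supplies a competitor of this length, and d is a minimizer. -/
theorem norm_step_le [CompleteSpace X] {x d : X} {r : Y} {θ : ℝ}
    (hx : x ∈ Metric.ball x₀ (1 / L)) (hd : d ∈ stepDirections F C x r)
    (hr : baseNorm F C x₀ (-r) ≤ θ * baseNorm F C x₀ (-F x)) :
    ‖d‖ ≤ (1 + θ) * baseNorm F C x₀ (-F x) / (1 - L * ‖x - x₀‖) := by
  obtain ⟨e, he, hen⟩ := H.exists_solution hx (-F x + -r)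
  have h1 : ‖d‖ ≤ ‖e‖ := hd.2 e (by
    show F x + fderiv ℝ F x e + r ∈ C
    rwa [show F x + fderiv ℝ F x e + r = fderiv ℝ F x e - (-F x + -r) by abel])
  refine h1.trans (hen.trans ?_)
  have h2 := H.baseNorm_add_le (-F x) (-r)
  have h3 := H.mul_norm_sub_lt_one hx
  exact div_le_div_of_nonneg_right (by linarith) (by linarith)

theorem baseNorm_neg_le_norm_step {x d : X} {r : Y} {θ : ℝ} (hx : x ∈ Metric.ball x₀ (1 / L))
    (hd : F x + fderiv ℝ F x d + r ∈ C)
    (hr : baseNorm F C x₀ r ≤ θ * baseNorm F C x₀ (-F x)) :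
    (1 - θ) * baseNorm F C x₀ (-F x) ≤ (1 + L * ‖x - x₀‖) * ‖d‖ := by
  have h1 := H.baseNorm_add_le (fderiv ℝ F x d) (r + -(F x + fderiv ℝ F x d + r))
  have h2 := H.baseNorm_add_le r (-(F x + fderiv ℝ F x d + r))
  have h3 : baseNorm F C x₀ (-(F x + fderiv ℝ F x d + r)) = 0 := leastNorm_neg_of_mem hd
  have h4 := H.baseNorm_fderiv_le hx d
  have e : fderiv ℝ F x d + (r + -(F x + fderiv ℝ F x d + r)) = -F x := by abel
  rw [e] at h1
  linarith

theorem baseNorm_neg_le_dist_solution {x z : X} (hx : x ∈ Metric.ball x₀ (1 / L))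
    (hz : z ∈ Metric.ball x₀ (1 / L)) (hzC : F z ∈ C) :
    baseNorm F C x₀ (-F x) ≤ (1 + L * ‖x - x₀‖ + L / 2 * ‖z - x‖) * ‖z - x‖ := by
  have hxd : x + (z - x) ∈ Metric.ball x₀ (1 / L) := by rwa [add_sub_cancel]
  have h1 := H.baseNorm_fderiv_le hx (z - x)
  have h2 := H.baseNorm_remainder_le hx hxd
  rw [add_sub_cancel] at h2
  have h3 : baseNorm F C x₀ (-F z) = 0 := leastNorm_neg_of_mem hzC
  have h4 := H.baseNorm_add_le (fderiv ℝ F x (z - x)) (F z - F x - fderiv ℝ F x (z - x) + -F z)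
  have h5 := H.baseNorm_add_le (F z - F x - fderiv ℝ F x (z - x)) (-F z)
  have e : fderiv ℝ F x (z - x) + (F z - F x - fderiv ℝ F x (z - x) + -F z) = -F x := by abel
  rw [e] at h4
  calc _ ≤ (1 + L * ‖x - x₀‖) * ‖z - x‖ + L / 2 * ‖z - x‖ ^ 2 := by linarith
    _ = _ := by ring

/-- Least-norm solutions v_k for -F(x_k) tend to 0, so F'(x₀)v_k + F(x_k) ∈ C passes to the limit.
-/
theorem mem_of_tendsto {x : ℕ → X} {z : X} (hx : Tendsto x atTop (𝓝 z)) (hF : ContinuousAt F z)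
    (hN : Tendsto (fun k => baseNorm F C x₀ (-F (x k))) atTop (𝓝 0)) : F z ∈ C := by
  choose v hv hvn using fun k => exists_leastNorm H.reflexive H.isClosed (H.solvable (-F (x k)))
  have h1 : Tendsto v atTop (𝓝 0) :=
    tendsto_zero_iff_norm_tendsto_zero.2 (hN.congr fun k => (hvn k).symm)
  have h2 : Tendsto (fun k => fderiv ℝ F x₀ (v k) - -F (x k)) atTop
      (𝓝 (fderiv ℝ F x₀ 0 - -F z)) :=
    (((fderiv ℝ F x₀).continuous.tendsto _).comp h1).sub (hF.tendsto.comp hx).neg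
  rw [map_zero, zero_sub, neg_neg] at h2
  exact H.isClosed.mem_of_tendsto h2 (Eventually.of_forall hv)

end LocalAssumptions

end LocalEstimates

/-! ### The scalar majorant iteration -/

section Majorant

/-- The quadratic majorant function. -/
noncomputable def majorant (L b a t : ℝ) : ℝ := b - a * t + L / 2 * t ^ 2

/-- The inexact Newton iteration for the majorant function. -/
noncomputable def majorantStep (L b a θ t : ℝ) : ℝ :=
  t + (1 + θ) * majorant L b a t / (1 - L * t)

/-- The relations between the parameters: `s = √(2bL)` and `a = (1 - θ) / (1 + θ)`. -/
structure MajorantParameters (L b θ s a : ℝ) : Prop where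
  L_pos : 0 < L
  b_pos : 0 < b
  θ_nonneg : 0 ≤ θ
  s_pos : 0 < s
  sq_s : s ^ 2 = 2 * b * L
  s_le : s ≤ a
  a_eq : a * (1 + θ) = 1 - θ

/-- The region in which the majorant iteration stays. -/
structure MajorantRegion (L b s a t : ℝ) : Prop where
  nonneg : 0 ≤ t
  mul_lt : L * t < s
  pos : 0 < majorant L b a t

namespace MajorantParameters

variable {L b θ s a t : ℝ} (P : MajorantParameters L b θ s a)

include P

theorem a_pos : 0 < a := P.s_pos.trans_le P.s_le

theorem a_le_one : a ≤ 1 := by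
  nlinarith [P.a_eq, P.θ_nonneg, mul_nonneg P.a_pos.le P.θ_nonneg]

theorem s_le_one : s ≤ 1 := P.s_le.trans P.a_le_one

theorem θ_lt_one : θ < 1 := by
  have := mul_pos P.a_pos (by linarith [P.θ_nonneg] : 0 < 1 + θ)
  linarith [P.a_eq]

theorem region_zero : MajorantRegion L b s a 0 :=
  ⟨le_rfl, by simpa using P.s_pos, by simpa [majorant] using P.b_pos⟩

theorem one_sub_pos (ht : MajorantRegion L b s a t) : 0 < 1 - L * t := by
  linarith [ht.mul_lt, P.s_le_one]

theorem le_majorantStep (ht : MajorantRegion L b s a t) : t ≤ majorantStep L b a θ t := by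
  have h1 := P.one_sub_pos ht
  have h2 := ht.pos
  have h3 := P.θ_nonneg
  have : 0 ≤ (1 + θ) * majorant L b a t / (1 - L * t) := by positivity
  rw [majorantStep]
  linarith

/-- The majorant function decreases in step with the error estimate for the method. -/
theorem le_majorant_step (ht : MajorantRegion L b s a t) :
    L / 2 * (majorantStep L b a θ t - t) ^ 2 + θ * majorant L b a t ≤
      majorant L b a (majorantStep L b a θ t) := by
  have h1 := P.one_sub_pos ht
  have hθ := P.θ_nonneg
  set φ := majorant L b a t with hφ
  set D := (1 + θ) * φ / (1 - L * t) with hD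
  have hDm : D * (1 - L * t) = (1 + θ) * φ := div_mul_cancel₀ _ h1.ne'
  have e : majorantStep L b a θ t = t + D := rfl
  have e2 : majorant L b a (t + D) = φ - (a - L * t) * D + L / 2 * D ^ 2 := by
    rw [hφ, majorant, majorant]; ring
  have hDφ : (1 + θ) * φ ≤ D := by
    rw [hD, le_div_iff₀ h1]
    have : 0 ≤ (1 + θ) * φ * (L * t) :=
      mul_nonneg (mul_nonneg (by linarith) ht.pos.le) (mul_nonneg P.L_pos.le ht.nonneg)
    linarith
  -- With D the step, the majorant at t + D equals -θφ + (1-a)D + (L/2)D². The choice of a makes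
  -- (1-a)D at least 2θφ.
  have h2 : (1 - a) * (1 + θ) = 2 * θ := by linarith [P.a_eq]
  have h3 := mul_le_mul_of_nonneg_left hDφ (by linarith [P.a_le_one] : 0 ≤ 1 - a)
  have h4 : (1 - a) * ((1 + θ) * φ) = 2 * θ * φ := by rw [← mul_assoc, h2]
  rw [e, e2, add_sub_cancel_left]
  linarith

/-- The step is at most the exact Newton step φ/(a - Lt) of the convex majorant, which cannot
overshoot; the majorant is nonpositive at s/L because s ≤ a. -/
theorem region_step (ht : MajorantRegion L b s a t) :
    MajorantRegion L b s a (majorantStep L b a θ t) := by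
  have h1 := P.one_sub_pos ht
  have hθ := P.θ_nonneg
  have hL := P.L_pos
  have hφ0 := ht.pos
  have hle := P.le_majorantStep ht
  have hstep := P.le_majorant_step ht
  have hD0 : 0 < majorantStep L b a θ t - t := by
    rw [majorantStep, add_sub_cancel_left]; positivity
  refine ⟨ht.nonneg.trans hle, ?_, ?_⟩
  · have hu : 0 < a - L * t := by linarith [ht.mul_lt, P.s_le]
    have h2 : (a - L * t) * (1 + θ) ≤ 1 - L * t := by
      nlinarith [P.a_eq, mul_nonneg (mul_nonneg hL.le ht.nonneg) hθ]
    set φ := majorant L b a t with hφ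
    have h3 : (a - L * t) * (majorantStep L b a θ t - t) ≤ φ := by
      rw [majorantStep, add_sub_cancel_left, ← mul_div_assoc, div_le_iff₀ h1, ← mul_assoc,
        mul_comm φ]
      exact mul_le_mul_of_nonneg_right h2 hφ0.le
    have h4 : L * φ ≤ (a - L * t) * (s - L * t) - (s - L * t) ^ 2 / 2 := by
      have e : L * φ = L * b - a * (L * t) + (L * t) ^ 2 / 2 := by rw [hφ, majorant]; ring
      have : L * b = s ^ 2 / 2 := by rw [P.sq_s]; ring
      have h5 := mul_le_mul_of_nonneg_right P.s_le P.s_pos.le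
      rw [e, this]
      nlinarith
    have h6 : 0 < (s - L * t) ^ 2 := pow_pos (by linarith [ht.mul_lt]) 2
    have h7 := mul_le_mul_of_nonneg_left h3 hL.le
    have h8 : (a - L * t) * (L * (majorantStep L b a θ t - t)) < (a - L * t) * (s - L * t) := by
      nlinarith
    have h9 := lt_of_mul_lt_mul_left h8 hu.le
    linarith
  · have : 0 < L / 2 * (majorantStep L b a θ t - t) ^ 2 := by positivity
    have := mul_nonneg hθ hφ0.le
    linarith

/-- The decrease of the residual over a step. -/
theorem residual_decrease {N : ℝ} (ht : MajorantRegion L b s a t) (hN0 : 0 ≤ N)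
    (hN : N ≤ majorant L b a t) {D : ℝ} (hD0 : 0 ≤ D) (hD : D ≤ (1 + θ) * N / (1 - L * t)) :
    L / 2 * D ^ 2 + θ * N ≤ (1 + θ ^ 2) / 2 * N := by
  have h1 := P.one_sub_pos ht
  have hθ := P.θ_nonneg
  have hL := P.L_pos
  have ha1 := P.a_le_one
  have hLt : 0 ≤ L * t := mul_nonneg hL.le ht.nonneg
  rw [le_div_iff₀ h1] at hD
  have h2 : (D * (1 - L * t)) ^ 2 ≤ ((1 + θ) * N) ^ 2 :=
    pow_le_pow_left₀ (mul_nonneg hD0 h1.le) hD 2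
  -- From s ≤ a, twice L times the majorant is at most (a - Lt)², and a - Lt ≤ a(1 - Lt) since a ≤
  -- 1.
  have h3 : L * N ≤ (a * (1 - L * t)) ^ 2 := by
    have e : L * majorant L b a t = s ^ 2 / 2 - a * (L * t) + (L * t) ^ 2 / 2 := by
      rw [majorant, P.sq_s]; ring
    have h4 := mul_le_mul_of_nonneg_left hN hL.le
    have h5 : s ^ 2 ≤ a ^ 2 := pow_le_pow_left₀ P.s_pos.le P.s_le 2
    have h6 : (a - L * t) ^ 2 ≤ (a * (1 - L * t)) ^ 2 :=
      pow_le_pow_left₀ (by linarith [ht.mul_lt, P.s_le]) (by nlinarith) 2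
    nlinarith [sq_nonneg (a - L * t)]
  have h7 : L * (D * (1 - L * t)) ^ 2 ≤ (1 - θ) ^ 2 * N * (1 - L * t) ^ 2 := by
    calc L * (D * (1 - L * t)) ^ 2 ≤ L * ((1 + θ) * N) ^ 2 := mul_le_mul_of_nonneg_left h2 hL.le
      _ = (1 + θ) ^ 2 * N * (L * N) := by ring
      _ ≤ (1 + θ) ^ 2 * N * (a * (1 - L * t)) ^ 2 := mul_le_mul_of_nonneg_left h3 (by positivity)
      _ = (a * (1 + θ)) ^ 2 * N * (1 - L * t) ^ 2 := by ring
      _ = _ := by rw [P.a_eq]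
  have h8 : L * D ^ 2 ≤ (1 - θ) ^ 2 * N := by
    refine le_of_mul_le_mul_right ?_ (pow_pos h1 2)
    linarith
  -- (1-θ)²/2 + θ = (1+θ²)/2.
  nlinarith

end MajorantParameters

theorem mem_ball_of_region {X : Type*} [NormedAddCommGroup X] {x₀ : X} {L b θ s a : ℝ}
    (P : MajorantParameters L b θ s a) {t : ℝ}
    (ht : MajorantRegion L b s a t) {x : X} (hx : ‖x - x₀‖ ≤ t) :
    x ∈ Metric.ball x₀ (1 / L) := by
  rw [mem_ball_iff_norm, lt_div_iff₀ P.L_pos]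
  nlinarith [ht.mul_lt, P.s_le_one, P.L_pos]

end Majorant

/-! ### Majorization and convergence of runs -/

section Run

variable {X Y : Type*} [NormedAddCommGroup X] [NormedSpace ℝ X]
  [NormedAddCommGroup Y] [NormedSpace ℝ Y]
  {F : X → Y} {C : ConvexCone ℝ Y} {x₀ : X} {L b θ s a : ℝ}

theorem AdmissibleResidual.baseNorm_le (H : LocalAssumptions F C x₀ L) (hθ : 0 ≤ θ) {x : X}
    {r : Y} (h : AdmissibleResidual F C x₀ θ x r) :
    baseNorm F C x₀ (-r) ≤ θ * baseNorm F C x₀ (-F x) ∧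
      baseNorm F C x₀ r ≤ θ * baseNorm F C x₀ (-F x) := by
  have hN : 0 ≤ θ * baseNorm F C x₀ (-F x) := mul_nonneg hθ (leastNorm_nonneg _)
  rw [AdmissibleResidual, setNorm_processInv H.reflexive H.isClosed (H.solvable _),
    setNorm_processInv H.reflexive H.isClosed (H.solvable _),
    setNorm_processInv H.reflexive H.isClosed (H.solvable _), ← ENNReal.ofReal_mul hθ,
    max_le_iff, ENNReal.ofReal_le_ofReal_iff hN, ENNReal.ofReal_le_ofReal_iff hN] at h
  exact h

theorem admissibleResidual_zero (H : LocalAssumptions F C x₀ L) (x : X) :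
    AdmissibleResidual F C x₀ θ x 0 := by
  have h : setNorm (processInv F C x₀ 0) = 0 := by
    rw [setNorm_processInv H.reflexive H.isClosed (H.solvable _), leastNorm_zero H.zero_mem,
      ENNReal.ofReal_zero]
  rw [AdmissibleResidual, neg_zero, h, max_self]
  exact zero_le

theorem IsRun.isPartialRun {x : ℕ → X} (h : IsRun F C x₀ θ x) (n : ℕ) :
    IsPartialRun F C x₀ θ n x :=
  ⟨h.1, fun k _ => h.2 k⟩

variable [CompleteSpace X]

/-- The estimates for a single step of the method. -/
structure StepEstimates (F : X → Y) (C : ConvexCone ℝ Y) (x₀ : X) (L θ t : ℝ) (x x' : X) :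
    Prop where
  norm_le : ‖x' - x‖ ≤ (1 + θ) * baseNorm F C x₀ (-F x) / (1 - L * t)
  residual_le : baseNorm F C x₀ (-F x') ≤
    L / 2 * ‖x' - x‖ ^ 2 + θ * baseNorm F C x₀ (-F x)
  le_norm : (1 - θ) * baseNorm F C x₀ (-F x) ≤ (1 + L * t) * ‖x' - x‖

theorem IsStep.estimates (H : LocalAssumptions F C x₀ L) (P : MajorantParameters L b θ s a)
    {t : ℝ} (ht : MajorantRegion L b s a t) {x x' : X} (hx : ‖x - x₀‖ ≤ t)
    (hN : baseNorm F C x₀ (-F x) ≤ majorant L b a t) (h : IsStep F C x₀ θ x x') :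
    StepEstimates F C x₀ L θ t x x' ∧ ‖x' - x‖ ≤ majorantStep L b a θ t - t := by
  obtain ⟨r, hr, d, hd, rfl⟩ := h
  obtain ⟨hr1, hr2⟩ := hr.baseNorm_le H P.θ_nonneg
  have hxb := mem_ball_of_region P ht hx
  have hN0 : 0 ≤ baseNorm F C x₀ (-F x) := leastNorm_nonneg _
  have hθ := P.θ_nonneg
  have h1 := P.one_sub_pos ht
  have hLx : L * ‖x - x₀‖ ≤ L * t := mul_le_mul_of_nonneg_left hx P.L_pos.le
  have hlen : ‖d‖ ≤ (1 + θ) * baseNorm F C x₀ (-F x) / (1 - L * t) :=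
    (H.norm_step_le hxb hd hr1).trans
      (div_le_div_of_nonneg_left (by positivity) h1 (by linarith))
  have hlen' : ‖d‖ ≤ majorantStep L b a θ t - t := by
    rw [majorantStep, add_sub_cancel_left]
    exact hlen.trans (div_le_div_of_nonneg_right
      (mul_le_mul_of_nonneg_left hN (by linarith)) h1.le)
  have hxd : x + d ∈ Metric.ball x₀ (1 / L) := by
    refine mem_ball_of_region P (P.region_step ht) ?_
    have := norm_add_le (x - x₀) d
    rw [show x - x₀ + d = x + d - x₀ by abel] at this
    linarith
  rw [add_sub_cancel_left]
  refine ⟨⟨by rwa [add_sub_cancel_left], ?_, ?_⟩, hlen'⟩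
  · rw [add_sub_cancel_left]
    have := H.baseNorm_neg_add_le hxb hxd hd.1
    linarith
  · rw [add_sub_cancel_left]
    refine (H.baseNorm_neg_le_norm_step hxb hd.1 hr2).trans ?_
    exact mul_le_mul_of_nonneg_right (by linarith) (norm_nonneg _)

/-- The sequence majorizing the iterates. -/
noncomputable def majorantSeq (L b a θ : ℝ) : ℕ → ℝ
  | 0 => 0
  | n + 1 => majorantStep L b a θ (majorantSeq L b a θ n)

theorem region_majorantSeq (P : MajorantParameters L b θ s a) (n : ℕ) :
    MajorantRegion L b s a (majorantSeq L b a θ n) := by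
  induction n with
  | zero => exact P.region_zero
  | succ n ih => exact P.region_step ih

/-- Distance and residual bounds must be carried together: each step estimate uses both. Partial
runs suffice, which is what well-definedness requires. -/
theorem IsPartialRun.bounds (H : LocalAssumptions F C x₀ L) (P : MajorantParameters L b θ s a)
    (h0 : baseNorm F C x₀ (-F x₀) ≤ b) {n : ℕ} {x : ℕ → X} (h : IsPartialRun F C x₀ θ n x) :
    ∀ k ≤ n, ‖x k - x₀‖ ≤ majorantSeq L b a θ k ∧
      baseNorm F C x₀ (-F (x k)) ≤ majorant L b a (majorantSeq L b a θ k) := by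
  intro k
  induction k with
  | zero =>
    intro _
    rw [h.1]
    simpa [majorantSeq, majorant] using h0
  | succ k ih =>
    intro hk
    obtain ⟨h1, h2⟩ := ih (by omega)
    have ht := region_majorantSeq P k
    obtain ⟨hE, hlen⟩ := (h.2 k (by omega)).estimates H P ht h1 h2
    have hm := P.le_majorant_step ht
    have hsq : ‖x (k + 1) - x k‖ ^ 2 ≤
        (majorantStep L b a θ (majorantSeq L b a θ k) - majorantSeq L b a θ k) ^ 2 :=
      pow_le_pow_left₀ (norm_nonneg _) hlen 2
    refine ⟨?_, ?_⟩
    · have := norm_add_le (x (k + 1) - x k) (x k - x₀)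
      rw [sub_add_sub_cancel] at this
      rw [majorantSeq]
      linarith
    · rw [majorantSeq]
      have h3 := mul_le_mul_of_nonneg_left hsq (by linarith [P.L_pos] : 0 ≤ L / 2)
      have h4 := mul_le_mul_of_nonneg_left h2 P.θ_nonneg
      linarith [hE.residual_le]

namespace IsRun

variable {x : ℕ → X} (h : IsRun F C x₀ θ x) (H : LocalAssumptions F C x₀ L)
  (P : MajorantParameters L b θ s a) (h0 : baseNorm F C x₀ (-F x₀) ≤ b)

include h H P h0

theorem norm_sub_le (k : ℕ) : ‖x k - x₀‖ ≤ majorantSeq L b a θ k :=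
  ((h.isPartialRun k).bounds H P h0 k le_rfl).1

theorem residual_le_majorant (k : ℕ) :
    baseNorm F C x₀ (-F (x k)) ≤ majorant L b a (majorantSeq L b a θ k) :=
  ((h.isPartialRun k).bounds H P h0 k le_rfl).2

theorem estimates (k : ℕ) :
    StepEstimates F C x₀ L θ (majorantSeq L b a θ k) (x k) (x (k + 1)) ∧
      ‖x (k + 1) - x k‖ ≤ majorantSeq L b a θ (k + 1) - majorantSeq L b a θ k :=
  (h.2 k).estimates H P (region_majorantSeq P k) (h.norm_sub_le H P h0 k)
    (h.residual_le_majorant H P h0 k)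

theorem residual_succ_le (k : ℕ) :
    baseNorm F C x₀ (-F (x (k + 1))) ≤ (1 + θ ^ 2) / 2 * baseNorm F C x₀ (-F (x k)) := by
  have hE := (h.estimates H P h0 k).1
  exact hE.residual_le.trans (P.residual_decrease (region_majorantSeq P k) (leastNorm_nonneg _)
    (h.residual_le_majorant H P h0 k) (norm_nonneg _) hE.norm_le)

theorem residual_le (k : ℕ) :
    baseNorm F C x₀ (-F (x k)) ≤ ((1 + θ ^ 2) / 2) ^ k * b := by
  induction k with
  | zero => rw [h.1]; simpa using h0
  | succ k ih =>
    refine (h.residual_succ_le H P h0 k).trans ?_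
    rw [pow_succ' ((1 + θ ^ 2) / 2), mul_assoc]
    exact mul_le_mul_of_nonneg_left ih (by positivity)

theorem residual_antitone : Antitone fun k => baseNorm F C x₀ (-F (x k)) := by
  refine antitone_nat_of_succ_le fun k => (h.residual_succ_le H P h0 k).trans ?_
  have h1 : (1 + θ ^ 2) / 2 ≤ 1 := by nlinarith [P.θ_nonneg, P.θ_lt_one]
  exact mul_le_of_le_one_left (leastNorm_nonneg _) h1

theorem tendsto_residual : Tendsto (fun k => baseNorm F C x₀ (-F (x k))) atTop (𝓝 0) := by
  have h1 : (1 + θ ^ 2) / 2 < 1 := by nlinarith [P.θ_nonneg, P.θ_lt_one]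
  have h2 := (tendsto_pow_atTop_nhds_zero_of_lt_one (by positivity) h1).mul_const b
  rw [zero_mul] at h2
  exact squeeze_zero (fun k => leastNorm_nonneg _) (h.residual_le H P h0) h2

theorem mul_norm_sub_lt (k : ℕ) : L * ‖x k - x₀‖ < s :=
  (mul_le_mul_of_nonneg_left (h.norm_sub_le H P h0 k) P.L_pos.le).trans_lt
    (region_majorantSeq P k).mul_lt

theorem mem_ball (k : ℕ) : x k ∈ Metric.ball x₀ (s / L) := by
  rw [mem_ball_iff_norm, lt_div_iff₀ P.L_pos, mul_comm]
  exact h.mul_norm_sub_lt H P h0 k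

theorem mem_ball_one_div (k : ℕ) : x k ∈ Metric.ball x₀ (1 / L) :=
  mem_ball_of_region P (region_majorantSeq P k) (h.norm_sub_le H P h0 k)

/-- Steps are dominated by the increments of the majorizing sequence, whose sums telescope below
s/L. -/
theorem cauchySeq : CauchySeq x := by
  refine cauchySeq_of_dist_le_of_summable
    (fun k => majorantSeq L b a θ (k + 1) - majorantSeq L b a θ k) (fun k => ?_) ?_
  · rw [dist_comm, dist_eq_norm]
    exact (h.estimates H P h0 k).2
  · refine summable_of_sum_range_le (c := s / L)
      (fun k => sub_nonneg.2 (P.le_majorantStep (region_majorantSeq P k))) fun n => ?_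
    rw [Finset.sum_range_sub]
    have h1 := (region_majorantSeq P n).mul_lt
    rw [majorantSeq, sub_zero, le_div_iff₀ P.L_pos]
    linarith

theorem norm_step_le (hs : s < 1) (k : ℕ) :
    ‖x (k + 1) - x k‖ ≤ (1 + θ) / (1 - s) * baseNorm F C x₀ (-F (x k)) := by
  refine (h.estimates H P h0 k).1.norm_le.trans ?_
  rw [div_mul_eq_mul_div]
  have h1 := (region_majorantSeq P k).mul_lt
  have h2 : 0 ≤ (1 + θ) * baseNorm F C x₀ (-F (x k)) :=
    mul_nonneg (by linarith [P.θ_nonneg]) (leastNorm_nonneg _)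
  exact div_le_div_of_nonneg_left h2 (by linarith) (by linarith)

theorem norm_step_succ_le (hs : s < 1) (k : ℕ) :
    ‖x (k + 1) - x (k + 2)‖ ≤ (1 + θ) / (1 - θ) *
      ((1 + θ) / 2 * (L / (1 - s)) * ‖x k - x (k + 1)‖ + θ * ((1 + s) / (1 - s))) *
        ‖x k - x (k + 1)‖ := by
  have hθ := P.θ_nonneg
  have hθ1 : 0 < 1 - θ := by linarith [P.θ_lt_one]
  have hs1 : 0 < 1 - s := by linarith
  have hL := P.L_pos
  have h1 := h.norm_step_le H P h0 hs (k + 1)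
  have hE := (h.estimates H P h0 k).1
  have ht := (region_majorantSeq P k).mul_lt
  rw [norm_sub_rev (x (k + 1)) (x (k + 2)), norm_sub_rev (x k)]
  set D := ‖x (k + 1) - x k‖ with hD
  have hD0 : 0 ≤ D := norm_nonneg _
  have h2 : baseNorm F C x₀ (-F (x k)) ≤ (1 + s) * D / (1 - θ) := by
    rw [le_div_iff₀ hθ1]
    have := mul_le_mul_of_nonneg_right (by linarith :
      1 + L * majorantSeq L b a θ k ≤ 1 + s) hD0
    linarith [hE.le_norm]
  have h3 : baseNorm F C x₀ (-F (x (k + 1))) ≤ L / 2 * D ^ 2 + θ * ((1 + s) * D / (1 - θ)) :=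
    hE.residual_le.trans (by linarith [mul_le_mul_of_nonneg_left h2 hθ])
  have h4 : L / 2 * D ^ 2 ≤ (1 + θ) / (1 - θ) * (L / 2 * D ^ 2) := by
    refine le_mul_of_one_le_left (by positivity) ?_
    rw [le_div_iff₀ hθ1]
    linarith
  calc _ ≤ (1 + θ) / (1 - s) * baseNorm F C x₀ (-F (x (k + 1))) := h1
    _ ≤ (1 + θ) / (1 - s) * ((1 + θ) / (1 - θ) * (L / 2 * D ^ 2) +
          θ * ((1 + s) * D / (1 - θ))) :=
        mul_le_mul_of_nonneg_left (by linarith) (by positivity)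
    _ = _ := by field_simp

/-- The error after a step, in terms of the residual before it. -/
theorem dist_limit_le (hs : s < 1) {z : X} (hz : Tendsto x atTop (𝓝 z)) {k : ℕ} {α : ℝ}
    (hα : α = θ + L / 2 * ((1 + θ) / (1 - s)) ^ 2 * baseNorm F C x₀ (-F (x k))) (hα1 : α < 1) :
    ‖z - x (k + 1)‖ ≤ (1 + θ) / (1 - s) * α / (1 - α) * baseNorm F C x₀ (-F (x k)) := by
  have hθ := P.θ_nonneg
  have hL := P.L_pos
  have hs1 : 0 < 1 - s := by linarith
  set M := (1 + θ) / (1 - s) with hM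
  have hM0 : 0 ≤ M := by positivity
  have hN0 : ∀ j, 0 ≤ baseNorm F C x₀ (-F (x j)) := fun j => leastNorm_nonneg _
  have hα0 : 0 ≤ α := by rw [hα]; have := hN0 k; positivity
  -- Residuals decrease, so the contraction factor at index k serves all later indices.
  have hstep : ∀ j, k ≤ j →
      baseNorm F C x₀ (-F (x (j + 1))) ≤ α * baseNorm F C x₀ (-F (x j)) := by
    intro j hj
    have h1 := (h.estimates H P h0 j).1.residual_le
    have h2 : ‖x (j + 1) - x j‖ ^ 2 ≤ (M * baseNorm F C x₀ (-F (x j))) ^ 2 :=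
      pow_le_pow_left₀ (norm_nonneg _) (h.norm_step_le H P h0 hs j) 2
    have h3 := mul_le_mul_of_nonneg_left h2 (by positivity : 0 ≤ L / 2)
    have h4 : baseNorm F C x₀ (-F (x j)) ≤ baseNorm F C x₀ (-F (x k)) :=
      h.residual_antitone H P h0 hj
    have h5 := mul_le_mul_of_nonneg_left h4
      (mul_nonneg (by positivity : 0 ≤ L / 2 * M ^ 2) (hN0 j))
    rw [hα]
    nlinarith
  have hgeo : ∀ n, baseNorm F C x₀ (-F (x (k + 1 + n))) ≤
      α * baseNorm F C x₀ (-F (x k)) * α ^ n := by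
    intro n
    induction n with
    | zero => simpa using hstep k le_rfl
    | succ n ih =>
      refine (hstep (k + 1 + n) (by omega)).trans ?_
      refine (mul_le_mul_of_nonneg_left ih hα0).trans (le_of_eq ?_)
      ring
  have hdist : ∀ n, dist (x (k + 1 + n)) (x (k + 1 + (n + 1))) ≤
      M * (α * baseNorm F C x₀ (-F (x k))) * α ^ n := by
    intro n
    rw [dist_comm, dist_eq_norm, mul_assoc]
    exact (h.norm_step_le H P h0 hs (k + 1 + n)).trans
      (mul_le_mul_of_nonneg_left (hgeo n) hM0)
  have hlim : Tendsto (fun n => x (k + 1 + n)) atTop (𝓝 z) := by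
    have := (tendsto_add_atTop_iff_nat (k + 1)).2 hz
    exact this.congr fun n => by rw [add_comm]
  have := dist_le_of_le_geometric_of_tendsto₀ α _ hα1 hdist hlim
  rw [add_zero, dist_comm, dist_eq_norm] at this
  refine this.trans (le_of_eq ?_)
  ring

/-- As residuals vanish, the factor α of `dist_limit_le` tends to θ; `baseNorm_neg_le_dist_solution`
turns the residual back into the error. -/
theorem limsup_ratio_le (hs : s < 1) {z : X} (hz : Tendsto x atTop (𝓝 z))
    (hzb : z ∈ Metric.ball x₀ (1 / L)) (hzC : F z ∈ C) :
    limsup (fun k => ‖z - x (k + 1)‖ₑ / ‖z - x k‖ₑ) atTop ≤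
      ENNReal.ofReal ((1 + θ) / (1 - s) * θ / (1 - θ) * (1 + s)) := by
  have hθ := P.θ_nonneg
  have hL := P.L_pos
  have hs1 : 0 < 1 - s := by linarith
  have hs0 := P.s_pos
  have hθ1 : 1 - θ ≠ 0 := by linarith [P.θ_lt_one]
  set N : ℕ → ℝ := fun k => baseNorm F C x₀ (-F (x k)) with hN
  have hNn : ∀ k, 0 ≤ N k := fun k => leastNorm_nonneg _
  set α : ℕ → ℝ := fun k => θ + L / 2 * ((1 + θ) / (1 - s)) ^ 2 * N k with hα
  have hαlim : Tendsto α atTop (𝓝 θ) := by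
    have := ((h.tendsto_residual H P h0).const_mul
      (L / 2 * ((1 + θ) / (1 - s)) ^ 2)).const_add θ
    simpa using this
  have helim : Tendsto (fun k => ‖z - x k‖) atTop (𝓝 0) := by
    simpa using (hz.const_sub z).norm
  have hA : Tendsto (fun k => (1 + θ) / (1 - s) * α k / (1 - α k) *
      (1 + s + L / 2 * ‖z - x k‖)) atTop (𝓝 ((1 + θ) / (1 - s) * θ / (1 - θ) * (1 + s))) := by
    have := ((hαlim.const_mul ((1 + θ) / (1 - s))).div (hαlim.const_sub 1) hθ1).mul
      ((helim.const_mul (L / 2)).const_add (1 + s))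
    simpa using this
  rw [← (ENNReal.tendsto_ofReal hA).limsup_eq]
  refine limsup_le_limsup ?_
  filter_upwards [hαlim.eventually_lt_const P.θ_lt_one] with k hk
  have hα0 : 0 ≤ α k := by have := hNn k; simp only [hα]; positivity
  have hc : 0 ≤ (1 + θ) / (1 - s) * α k / (1 - α k) := by
    have : 0 < 1 - α k := by linarith
    positivity
  -- Valid for a zero denominator too, so finite termination needs no separate case.
  refine ENNReal.div_le_of_le_mul ?_
  rw [← ofReal_norm, ← ofReal_norm, ← ENNReal.ofReal_mul (mul_nonneg hc (by positivity))]
  refine ENNReal.ofReal_le_ofReal ?_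
  refine (h.dist_limit_le H P h0 hs hz rfl hk).trans ?_
  rw [mul_assoc ((1 + θ) / (1 - s) * α k / (1 - α k))]
  refine mul_le_mul_of_nonneg_left ?_ hc
  refine (H.baseNorm_neg_le_dist_solution (h.mem_ball_one_div H P h0 k) hzb hzC).trans ?_
  refine mul_le_mul_of_nonneg_right ?_ (norm_nonneg _)
  linarith [h.mul_norm_sub_lt H P h0 k]

end IsRun

end Run

/-! ### The threshold for Q-linear convergence -/

section RateConstant

theorem linear_rate_lt_one {θ s : ℝ} (hθ0 : 0 ≤ θ) (hθ1 : θ < 1) (hs1 : s < 1)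
    (h : θ < (-2 * (2 - s) + √(5 * s ^ 2 - 22 * s + 21)) / (5 - s)) :
    (1 + θ) / (1 - θ) * ((1 + θ) / 2 + 2 * θ / (1 - s)) < 1 := by
  have h1 : 0 < 1 - s := by linarith
  have h2 : 0 < 1 - θ := by linarith
  rw [lt_div_iff₀ (by linarith)] at h
  have h3 : 0 ≤ θ * (5 - s) + 2 * (2 - s) := by
    have := mul_nonneg hθ0 (by linarith : 0 ≤ 5 - s)
    linarith
  have h4 := (Real.lt_sqrt h3).1 (by linarith)
  -- Clearing denominators, q < 1 reads (5-s)θ² + (8-4s)θ - (1-s) < 0; the threshold is the positive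
  -- root.
  have h5 : (5 - s) * ((5 - s) * θ ^ 2 + (8 - 4 * s) * θ - (1 - s)) < (5 - s) * 0 := by
    nlinarith
  have h6 := lt_of_mul_lt_mul_left h5 (by linarith : 0 ≤ 5 - s)
  rw [div_add_div _ _ two_ne_zero h1.ne', div_mul_div_comm, div_lt_one (by positivity)]
  nlinarith

end RateConstant

end InexactNewton

theorem theorem3
    {X Y : Type*} [NormedAddCommGroup X] [NormedSpace ℝ X] [CompleteSpace X]
    [NormedAddCommGroup Y] [NormedSpace ℝ Y] [CompleteSpace Y]
    (hX : InexactNewton.IsReflexiveSpace X)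
    (Ω : Set X) (hΩ : IsOpen Ω) (F : X → Y) (hF : ContDiffOn ℝ 1 F Ω)
    (C : ConvexCone ℝ Y) (hCne : (C : Set Y).Nonempty) (hCcl : IsClosed (C : Set Y))
    (x₀ : X) (hx₀ : x₀ ∈ Ω) (L b θ : ℝ) (hL : 0 < L) (hb : 0 < b)
    (hRob : InexactNewton.RobinsonCondition F C x₀)
    (hLip : InexactNewton.AffineLipschitz F C Ω x₀ L)
    (hFb : InexactNewton.setNorm (InexactNewton.processInv F C x₀ (-F x₀)) ≤ ENNReal.ofReal b)
    (hθ0 : 0 ≤ θ)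
    (hθ : θ ≤ (1 - Real.sqrt (2 * b * L)) / (1 + Real.sqrt (2 * b * L))) :
    -- the method never breaks down, whatever choices were made so far
    (∀ (n : ℕ) (x : ℕ → X), InexactNewton.IsPartialRun F C x₀ θ n x →
      x n ∈ Ω ∧ (∃ r, InexactNewton.AdmissibleResidual F C x₀ θ (x n) r) ∧
        ∀ r, InexactNewton.AdmissibleResidual F C x₀ θ (x n) r →
          (InexactNewton.stepDirections F C (x n) r).Nonempty) ∧
    -- properties of every sequence it generates
    (∀ x : ℕ → X, InexactNewton.IsRun F C x₀ θ x →
      (∀ k, InexactNewton.setNorm (InexactNewton.processInv F C x₀ (-F (x k))) ≤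
        ENNReal.ofReal (((1 + θ ^ 2) / 2) ^ k * b)) ∧
      (∀ k, x k ∈ Metric.ball x₀ (Real.sqrt (2 * b * L) / L)) ∧
      ∃ xs : X, Tendsto x atTop (𝓝 xs) ∧
        xs ∈ Metric.closedBall x₀ (Real.sqrt (2 * b * L) / L) ∧
        (xs ∈ Ω → F xs ∈ C) ∧
        (2 * b * L < 1 →
          xs ∈ Ω ∧
          (∀ k, ‖x (k + 1) - x (k + 2)‖ ≤
            (1 + θ) / (1 - θ) *
              ((1 + θ) / 2 * (L / (1 - Real.sqrt (2 * b * L))) * ‖x k - x (k + 1)‖ +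
                θ * ((1 + Real.sqrt (2 * b * L)) / (1 - Real.sqrt (2 * b * L)))) *
              ‖x k - x (k + 1)‖) ∧
          -- in `ℝ≥0∞`, `0 / 0 = 0` (finite termination) and `a / 0 = ∞` for `a ≠ 0`
          limsup (fun k => ‖xs - x (k + 1)‖ₑ / ‖xs - x k‖ₑ) atTop ≤
            ENNReal.ofReal ((1 + θ) / (1 - θ) *
              ((1 + θ) / 2 + 2 * θ / (1 - Real.sqrt (2 * b * L)))) ∧
          (θ < (-2 * (2 - Real.sqrt (2 * b * L)) +
                Real.sqrt (10 * b * L - 22 * Real.sqrt (2 * b * L) + 21)) /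
                (5 - Real.sqrt (2 * b * L)) →
            (1 + θ) / (1 - θ) *
              ((1 + θ) / 2 + 2 * θ / (1 - Real.sqrt (2 * b * L))) < 1))) := by
  have hD : 0 < 2 * b * L := by positivity
  have hD5 : 10 * b * L = 5 * √(2 * b * L) ^ 2 := by rw [Real.sq_sqrt hD.le]; ring
  have hlt : 2 * b * L < 1 → √(2 * b * L) < 1 := fun h => by
    rwa [Real.sqrt_lt' one_pos, one_pow]
  have hsq : √(2 * b * L) ^ 2 = 2 * b * L := Real.sq_sqrt hD.le
  have hs0 : 0 < √(2 * b * L) := Real.sqrt_pos.2 hD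
  rw [hD5]
  set s := √(2 * b * L) with hs
  have P : InexactNewton.MajorantParameters L b θ s ((1 - θ) / (1 + θ)) := by
    refine ⟨hL, hb, hθ0, hs0, hsq, ?_, div_mul_cancel₀ _ (by linarith)⟩
    -- θ ≤ (1-s)/(1+s) and s ≤ (1-θ)/(1+θ) both say θ + s + θs ≤ 1.
    rw [le_div_iff₀ (by linarith)] at hθ ⊢
    linarith
  have h0 := InexactNewton.zero_mem_of_isClosed hCne hCcl
  have hsol := fun y => hRob.exists_solution y
  have H : InexactNewton.LocalAssumptions F C x₀ L :=
    { reflexive := hX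
      isClosed := hCcl
      zero_mem := h0
      pos := hL
      solvable := hsol
      differentiableAt := fun x hx =>
        (hF.differentiableOn one_ne_zero).differentiableAt (hΩ.mem_nhds (hLip.1 hx))
      lipschitz := fun x hx y hy d => hLip.leastNorm_le hX hCcl h0 hL.le hsol hx hy d }
  have hN0 : InexactNewton.baseNorm F C x₀ (-F x₀) ≤ b := by
    rwa [InexactNewton.setNorm_processInv hX hCcl (hsol _),
      ENNReal.ofReal_le_ofReal_iff hb.le] at hFb
  refine ⟨fun n x hx => ?_, fun x hx => ?_⟩
  · have hxb := InexactNewton.mem_ball_of_region P (InexactNewton.region_majorantSeq P n)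
      (hx.bounds H P hN0 n le_rfl).1
    exact ⟨hLip.1 hxb, ⟨0, InexactNewton.admissibleResidual_zero H _⟩,
      fun r _ => H.stepDirections_nonempty hxb r⟩
  · obtain ⟨xs, hxs⟩ := cauchySeq_tendsto_of_complete (hx.cauchySeq H P hN0)
    have hxsb : xs ∈ Metric.closedBall x₀ (s / L) :=
      Metric.isClosed_closedBall.mem_of_tendsto hxs (Eventually.of_forall fun k =>
        Metric.ball_subset_closedBall (hx.mem_ball H P hN0 k))
    have hsolve : xs ∈ Ω → F xs ∈ C := fun h =>
      H.mem_of_tendsto hxs (hF.continuousOn.continuousAt (hΩ.mem_nhds h))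
        (hx.tendsto_residual H P hN0)
    refine ⟨fun k => ?_, hx.mem_ball H P hN0, xs, hxs, hxsb, hsolve, fun hlt1 => ?_⟩
    · rw [InexactNewton.setNorm_processInv hX hCcl (hsol _)]
      exact ENNReal.ofReal_le_ofReal (hx.residual_le H P hN0 k)
    have hs1 : s < 1 := hlt hlt1
    have hball : xs ∈ Metric.ball x₀ (1 / L) :=
      Metric.closedBall_subset_ball (div_lt_div_of_pos_right hs1 hL) hxsb
    have hΩs := hLip.1 hball
    refine ⟨hΩs, hx.norm_step_succ_le H P hN0 hs1, ?_,
      fun h => InexactNewton.linear_rate_lt_one hθ0 P.θ_lt_one hs1 h⟩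
    refine (hx.limsup_ratio_le H P hN0 hs1 hxs hball (hsolve hΩs)).trans
      (ENNReal.ofReal_le_ofReal ?_)
    have h1 : 0 < 1 - s := by linarith
    have h2 : 0 < 1 - θ := by linarith [P.θ_lt_one]
    rw [show (1 + θ) / (1 - s) * θ / (1 - θ) * (1 + s) =
      (1 + θ) / (1 - θ) * (θ * (1 + s) / (1 - s)) by field_simp]
    refine mul_le_mul_of_nonneg_left ?_ (by positivity)
    -- The limsup bound already proved is sharper than q: 1 + s ≤ 2, and the term (1+θ)/2 is spare.
    have h3 : θ * (1 + s) / (1 - s) ≤ 2 * θ / (1 - s) :=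
      div_le_div_of_nonneg_right (by nlinarith) h1.le
    linarith
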